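/- **Corollary 5.** Consider an online optimization problem with partial feedback over $T$ rounds: a finite action set $\mathcal A$; environment parameters $\Theta\in\mathcal O$ with prior $\mathbb P_\Theta$; in each round $t=1,\dots,T$ an outcome vector $Y_t=(Y_{t,a})_{a\in\mathcal A}$ with entries in $\mathcal Y'$, drawn from a fixed kernel $\mathbb P_{Y|\Theta}$ independently of the past given $\Theta$; a static state $S$ independent of $\Theta$ and of the outcomes; and a reward $r(Y_t,a)=r'(Y_{t,a})$ with values in $[0,1]$ (the spaces $\mathcal O$ and $\mathcal Y'$ are standard Borel, the maps measurable). Let $\gamma^\star:\mathcal O\to\mathcal A$ be an optimal rule, i.e. playing $\gamma^\star(\Theta)$ in every round attains the maximum of $\mathbb E[\sum_{t=1}^T r(Y_t,\psi_t(S,\Theta))]$ over all policies $\psi$ that know $S$ and $\Theta$, and let $A^\star=\gamma^\star(\Theta)$. Let $\hat H^t=((\hat A_1,Y_{1,\hat A_1}),\dots,(\hat A_{t-1},Y_{t-1,\hat A_{t-1}}))$ be the history under Thompson sampling: in round $t$, $\hat\Theta_t$ is drawn from the posterior $\mathbb P_{\Theta|\hat H^t}$, conditionally independently of $(\Theta,Y_t)$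 given $\hat H^t$, the action $\hat A_t=\gamma^\star(\hat\Theta_t)$ is played and $Y_{t,\hat A_t}$ is observed. Let $\mathbb W(\mathbb P,\mathbb Q)=\inf_{\mathbb D}\mathbb D(\{(y,y'):y\ne y'\})$, the infimum over all couplings $\mathbb D$ of $\mathbb P$ and $\mathbb Q$, be the Wasserstein distance of order one for the discrete metric on $\mathcal Y'$, and let $\mathrm H(A^\star)=-\sum_a\mathbb P(A^\star=a)\log\mathbb P(A^\star=a)$ (natural logarithm). Then $$\sum_{t=1}^T\mathbb E\big[\mathbb W(\mathbb P_{Y_{t,A^\star}|A^\star,\hat H^t},\,\mathbb P_{Y_{t,A^\star}|\hat H^t})\big]\le\sqrt{\tfrac12\,|\mathcal A|\,\mathrm H(A^\star)\,T},$$ where, on the event $A^\star=a$, the two laws are $\mathbb P_{Y_{t,a}|A^\star=a,\hat H^t}$ and $\mathbb P_{Y_{t,a}|\hat H^t}$ (the component index is fixed at the value of $A^\star$ before conditioning on $\hat H^t$ alone). If moreover the outcome is perfectly revealed by each per-action outcome, i.e. for every $a\in\mathcal A$ there is a measurable $f_a:\mathcal Y'\to\mathcal Y'^{\mathcal A}$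 with $Y_t=f_a(Y_{t,a})$ almost surely, then $$\sum_{t=1}^T\mathbb E\big[\mathbb W(\mathbb P_{Y_{t,A^\star}|A^\star,\hat H^t},\,\mathbb P_{Y_{t,A^\star}|\hat H^t})\big]\le\sqrt{\tfrac12\,\mathrm H(A^\star)\,T}.$$ -/

import Mathlib

open MeasureTheory ProbabilityTheory
open scoped ENNReal

noncomputable section

/-- An online optimization problem with partial feedback, as a static-state Bayesian decision
problem: a (constant) state `S ∼ stateLaw`, environment parameters `Θ ∼ prior`, and, at every round,
an outcome vector `Y_t = (Y_{t,a})_{a ∈ A}` drawn from `outcome Θ` independently of the past given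
`Θ`. The state is independent of the parameters and the outcomes. The reward of action `a` under the
outcome `y` is `pref (y a)`. -/
structure PartialFeedbackProblem (S O A Y : Type*) [MeasurableSpace S] [MeasurableSpace O]
    [MeasurableSpace Y] where
  stateLaw : Measure S
  stateLaw_prob : IsProbabilityMeasure stateLaw
  prior : Measure O
  prior_prob : IsProbabilityMeasure prior
  outcome : Kernel O (A → Y)
  outcome_markov : IsMarkovKernel outcome
  pref : Y → ℝ
  pref_measurable : Measurable pref

attribute [instance] PartialFeedbackProblem.stateLaw_prob PartialFeedbackProblem.prior_prob
  PartialFeedbackProblem.outcome_markov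

/-- Kantorovich cost of order one between `μ` and `ν` for the cost `c`: infimum over all couplings
of the expected cost. -/
def wassersteinOne {X : Type*} [MeasurableSpace X] (c : X → X → ℝ≥0∞) (μ ν : Measure X) : ℝ≥0∞ :=
  ⨅ (D : Measure (X × X)) (_ : D.map Prod.fst = μ) (_ : D.map Prod.snd = ν), ∫⁻ p, c p.1 p.2 ∂D

open Classical in
/-- The discrete metric (Hamming distortion). -/
def discreteMetric {X : Type*} (x y : X) : ℝ≥0∞ := if x = y then 0 else 1

namespace PartialFeedbackProblem

variable {S O A Y : Type*} [MeasurableSpace S] [MeasurableSpace O] [MeasurableSpace A]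
  [MeasurableSpace Y]

/-- The reward function `r(y, a) = r'(y_a)`. -/
def reward (P : PartialFeedbackProblem S O A Y) (y : A → Y) (a : A) : ℝ := P.pref (y a)

/-- Expected cumulative reward over `T` rounds of an agent that knows `Θ` and plays `ψ_t(S, Θ)`. -/
def informedReward (P : PartialFeedbackProblem S O A Y) (T : ℕ) (ψ : ℕ → S × O → A) : ℝ :=
  ∑ t ∈ Finset.range T,
    ∫ p, P.reward p.2 (ψ t p.1) ∂((P.stateLaw.prod P.prior) ⊗ₘ (Kernel.prodMkLeft S P.outcome))

/-- `γ` is an optimal decision rule: always playing `γ(Θ)` attains the maximal expected cumulative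
reward among all (measurable) policies that know `S` and `Θ`. -/
def IsOptimalRule (P : PartialFeedbackProblem S O A Y) (T : ℕ) (γ : O → A) : Prop :=
  Measurable γ ∧
    ∀ ψ : ℕ → S × O → A, (∀ t, Measurable (ψ t)) →
      P.informedReward T ψ ≤ P.informedReward T (fun _ p => γ p.2)

/-- Shannon entropy (in nats) of the optimal action `A⋆ = γ(Θ)`. -/
def optEntropy [Fintype A] (P : PartialFeedbackProblem S O A Y) (γ : O → A) : ℝ :=
  ∑ a, Real.negMulLog ((P.prior.map γ).real {a})

/-- The outcome vector is perfectly revealed by each of its components: for every action `a` there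
is a measurable map recovering `Y_t` almost surely from `Y_{t,a}`. -/
def PerfectlyRevealed (P : PartialFeedbackProblem S O A Y) : Prop :=
  ∀ a : A, ∃ f : Y → A → Y, Measurable f ∧ ∀ᵐ θ ∂P.prior, ∀ᵐ y ∂(P.outcome θ), f (y a) = y

/-- Joint law of `Θ` and of the history of the first `t` rounds
`((Â_1, Y_{1,Â_1}), …, (Â_t, Y_{t,Â_t}))` under Thompson sampling: in each round, given the history
`h` and `Θ = θ`, a parameter `Θ̂` is drawn from the posterior of `Θ` given `h` and, independently,
an outcome `y` from `outcome θ`; the action `γ(Θ̂)` is played and `y (γ(Θ̂))` is observed. -/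
def thompsonLaw [StandardBorelSpace O] [Nonempty O] (P : PartialFeedbackProblem S O A Y)
    (γ : O → A) : (t : ℕ) → FiniteMeasure (O × (Fin t → A × Y))
  | 0 => ⟨P.prior.map (fun θ => (θ, Fin.elim0)), inferInstance⟩
  | t + 1 =>
    let μ : Measure (O × (Fin t → A × Y)) := P.thompsonLaw γ t
    let posterior : Kernel (Fin t → A × Y) O := condDistrib Prod.fst Prod.snd μ
    ⟨(μ ⊗ₘ (Kernel.prodMkLeft O posterior ×ₖ Kernel.prodMkRight (Fin t → A × Y) P.outcome)).map
      (fun p => (p.1.1, Fin.snoc (α := fun _ => A × Y) p.1.2 (γ p.2.1, p.2.2 (γ p.2.1)))),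
      inferInstance⟩

variable [StandardBorelSpace O] [Nonempty O]

/-- Joint law of `((Θ, Ĥ), Y)`, where `Ĥ` is the history of the first `t` rounds of Thompson
sampling and `Y` is the full outcome vector of the following round. -/
def roundLaw (P : PartialFeedbackProblem S O A Y) (γ : O → A) (t : ℕ) :
    Measure ((O × (Fin t → A × Y)) × (A → Y)) :=
  (P.thompsonLaw γ t : Measure (O × (Fin t → A × Y))) ⊗ₘ
    (Kernel.prodMkRight (Fin t → A × Y) P.outcome)

instance (P : PartialFeedbackProblem S O A Y) (γ : O → A) (t : ℕ) :
    IsFiniteMeasure (P.roundLaw γ t) := by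
  unfold roundLaw; infer_instance

variable [StandardBorelSpace Y] [Nonempty Y]

/-- The conditional law `P_{Y_a | A⋆ = b, Ĥ = h}`, with `A⋆ = γ(Θ)`. -/
def outcomeGivenOptHist (P : PartialFeedbackProblem S O A Y) (γ : O → A) (t : ℕ) (a b : A)
    (h : Fin t → A × Y) : Measure Y :=
  condDistrib (fun ω => ω.2 a) (fun ω => (γ ω.1.1, ω.1.2)) (P.roundLaw γ t) (b, h)

/-- The conditional law `P_{Y_a | Ĥ = h}`. -/
def outcomeGivenHist (P : PartialFeedbackProblem S O A Y) (γ : O → A) (t : ℕ) (a : A)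
    (h : Fin t → A × Y) : Measure Y :=
  condDistrib (fun ω => ω.2 a) (fun ω => ω.1.2) (P.roundLaw γ t) h

/-- The bound `∑_t 𝔼[W(P_{Y_{t,A⋆} | A⋆, Ĥ^t}, P_{Y_{t,A⋆} | Ĥ^t})]` with the discrete metric on the
per-action outcomes. In both laws the index of the component is frozen at the value of `A⋆`, i.e.
on `A⋆ = a` they are `P_{Y_{t,a} | A⋆ = a, Ĥ^t}` and `P_{Y_{t,a} | Ĥ^t}`. -/
def wassersteinBound (P : PartialFeedbackProblem S O A Y) (γ : O → A) (T : ℕ) : ℝ≥0∞ :=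
  ∑ t ∈ Finset.range T,
    ∫⁻ ω, wassersteinOne discreteMetric
      (P.outcomeGivenOptHist γ t (γ ω.1) (γ ω.1) ω.2)
      (P.outcomeGivenHist γ t (γ ω.1) ω.2) ∂(P.thompsonLaw γ t : Measure (O × (Fin t → A × Y)))

end PartialFeedbackProblem

end

/-!
Pinsker's inequality, weighted by AM-GM with a free parameter `l > 0`, bounds a total variation
distance by `l / 2` times a relative entropy plus a constant over `l`. By Bayes' rule the expected
distance between the laws of `Y_{t,A⋆}` is a sum over actions of expected posterior decreases
`(ℙ(A⋆ = a | Ĥ) - ℙ(A⋆ = a | Ĥ, Y_{t,a}))⁺`, and since the action played is itself drawn from the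
posterior of `A⋆`, the relative entropies appearing there add up to the information about `A⋆`
gained in the round, that is, to the drop of the expected posterior entropy of `A⋆`. These drops
telescope to at most `H(A⋆)`, so the bound is `l / 2 * H(A⋆) + C * T / (2 * l)` for every `l > 0`,
where `C = |A| / 2`, or `C = 1 / 2` if every component reveals the whole outcome. Optimizing over
`l` only at the end avoids the Cauchy-Schwarz inequalities over actions and rounds.
-/

section Pinsker

open InformationTheory

lemma hasDerivAt_klFun_sub_sq {u : ℝ} (hu : u ≠ 0) :
    HasDerivAt (fun u => (2 * u + 4) * klFun u - 3 * (u - 1) ^ 2)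
      (4 * (u + 1) * Real.log u - 8 * (u - 1)) u := by
  have h := (((hasDerivAt_id u).const_mul 2).add_const 4).mul (hasDerivAt_klFun hu)
  refine (h.sub ((((hasDerivAt_id u).sub_const 1).pow 2).const_mul 3)).congr_deriv ?_
  simp only [klFun_apply, id, Nat.cast_ofNat]
  ring

lemma hasDerivAt_mul_log_sub {u : ℝ} (hu : u ≠ 0) :
    HasDerivAt (fun u => 4 * (u + 1) * Real.log u - 8 * (u - 1))
      (4 * (Real.log u - (1 - u⁻¹))) u := by
  have h := (((hasDerivAt_id u).add_const 1).const_mul 4).mul (Real.hasDerivAt_log hu)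
  refine (h.sub (((hasDerivAt_id u).sub_const 1).const_mul 8)).congr_deriv ?_
  simp only [id]
  field_simp
  ring

lemma convexOn_klFun_sub_sq :
    ConvexOn ℝ (Set.Ici 0) fun u => (2 * u + 4) * klFun u - 3 * (u - 1) ^ 2 := by
  refine convexOn_of_hasDerivWithinAt2_nonneg (convex_Ici 0)
    (by have := continuous_klFun; fun_prop)
    (fun u hu => (hasDerivAt_klFun_sub_sq ?_).hasDerivWithinAt)
    (fun u hu => (hasDerivAt_mul_log_sub ?_).hasDerivWithinAt) fun u hu => ?_
  all_goals rw [interior_Ici] at hu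
  · exact hu.ne'
  · exact hu.ne'
  · linarith [Real.one_sub_inv_le_log_of_pos hu]

lemma three_mul_sq_le_klFun {u : ℝ} (hu : 0 ≤ u) :
    3 * (u - 1) ^ 2 ≤ (2 * u + 4) * klFun u := by
  have hderiv : derivWithin (fun u => (2 * u + 4) * klFun u - 3 * (u - 1) ^ 2) (Set.Ioi 1) 1 = 0 :=
    ((hasDerivAt_klFun_sub_sq one_ne_zero).hasDerivWithinAt.derivWithin
      (uniqueDiffWithinAt_Ioi 1)).trans (by simp)
  have hmin := convexOn_klFun_sub_sq.isMinOn_of_rightDeriv_eq_zero (by simp) hderiv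
    (Set.mem_Ici.2 hu)
  simpa [klFun_one] using hmin

/-- The summand `x log (x / p) - x + p` of the relative entropy of `x` with respect to `p`, in the
form `p · klFun (x / p)`; it is `0` at `p = 0`. -/
noncomputable def klTerm (x p : ℝ) : ℝ := p * klFun (x / p)

lemma klTerm_nonneg {x p : ℝ} (hx : 0 ≤ x) (hp : 0 ≤ p) : 0 ≤ klTerm x p :=
  mul_nonneg hp (klFun_nonneg (div_nonneg hx hp))

lemma klTerm_eq {x p : ℝ} (h : p = 0 → x = 0) :
    klTerm x p = -Real.negMulLog x - x * Real.log p - x + p := by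
  rcases eq_or_ne p 0 with rfl | hp
  · simp [klTerm, h rfl]
  rcases eq_or_ne x 0 with rfl | hx
  · simp [klTerm, klFun_zero]
  rw [klTerm, klFun_apply, Real.log_div hx hp, Real.negMulLog]
  field_simp
  ring

lemma three_mul_sub_sq_le_klTerm {x p : ℝ} (hx : 0 ≤ x) (hp : 0 < p) :
    3 * (p - x) ^ 2 ≤ (2 * x + 4 * p) * klTerm x p := by
  have h := mul_le_mul_of_nonneg_left (three_mul_sq_le_klFun (div_nonneg hx hp.le)) (sq_nonneg p)
  calc 3 * (p - x) ^ 2 = p ^ 2 * (3 * (x / p - 1) ^ 2) := by field_simp; ring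
    _ ≤ p ^ 2 * ((2 * (x / p) + 4) * klFun (x / p)) := h
    _ = (2 * x + 4 * p) * klTerm x p := by rw [klTerm]; field_simp

/-- Pinsker's inequality with its square root linearized by AM-GM; the weights `1 / 12` and `2` are
such that the last term integrates to `1 / (4 * l)`, which is what the sharp constant requires. -/
lemma posPart_sub_le_klTerm {x p l : ℝ} (hx : 0 ≤ x) (hp : 0 < p) (hl : 0 < l) :
    (p - x)⁺ ≤ (p - x) / 2 + l / 2 * klTerm x p + (x + 2 * p) / (12 * l) := by
  have hkl := klTerm_nonneg hx hp.le
  have amgm : |p - x| ≤ l * klTerm x p + (x + 2 * p) / (6 * l) := by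
    refine abs_le_of_sq_le_sq ?_ (by positivity)
    have hprod : 4 * (l * klTerm x p) * ((x + 2 * p) / (6 * l))
        = (2 * x + 4 * p) * klTerm x p / 3 := by field_simp; ring
    linarith [three_mul_sub_sq_le_klTerm hx hp,
      four_mul_le_sq_add (l * klTerm x p) ((x + 2 * p) / (6 * l))]
  have hsplit : (x + 2 * p) / (6 * l) = 2 * ((x + 2 * p) / (12 * l)) := by field_simp; norm_num
  have habs := add_abs_eq_two_nsmul_posPart (p - x)
  rw [two_nsmul] at habs
  linarith

lemma posPart_sub_le_mul_klTerm {x p w l : ℝ} (hx : 0 ≤ x) (hp : 0 ≤ p) (h : p = 0 → x = 0)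
    (hpw : p ≤ w) (hl : 0 < l) :
    (p - x)⁺ ≤ (p - x) / 2 + l / 2 * (w * klTerm x p)
      + (x * w⁻¹ + 2 * (p * w⁻¹)) / (12 * l) := by
  rcases hp.eq_or_lt with rfl | hp0
  · simp [h rfl, klTerm]
  have hw : 0 < w := hp0.trans_le hpw
  refine (posPart_sub_le_klTerm hx hp0 (mul_pos hl hw)).trans_eq ?_
  field_simp

lemma le_sqrt_mul_of_forall_le {W H C : ℝ} (hH : 0 ≤ H) (hC : 0 ≤ C)
    (h : ∀ l : ℝ, 0 < l → W ≤ l / 2 * H + C / (2 * l)) : W ≤ √(H * C) := by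
  rcases le_or_gt W 0 with hW | hW
  · exact hW.trans (Real.sqrt_nonneg _)
  have hquad : ∀ l : ℝ, 0 ≤ H * (l * l) + -(2 * W) * l + C := fun l => by
    rcases le_or_gt l 0 with hl | hl
    · nlinarith [mul_nonneg hH (mul_self_nonneg l)]
    · have hmul := mul_le_mul_of_nonneg_left (h l hl) (by positivity : 0 ≤ 2 * l)
      have : 2 * l * (l / 2 * H + C / (2 * l)) = H * (l * l) + C := by field_simp
      linarith
  have hdiscrim := discrim_le_zero hquad
  rw [discrim] at hdiscrim
  exact Real.le_sqrt_of_sq_le (by linarith)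

end Pinsker

section Coupling

variable {X : Type*}

lemma discreteMetric_self (x : X) : discreteMetric x x = 0 := if_pos rfl

lemma discreteMetric_le_one (x y : X) : discreteMetric x y ≤ 1 := by
  rw [discreteMetric]
  split_ifs <;> simp

variable [MeasurableSpace X]

lemma wassersteinOne_le {c : X → X → ℝ≥0∞} {μ ν : Measure X} (D : Measure (X × X))
    (hfst : D.map Prod.fst = μ) (hsnd : D.map Prod.snd = ν) :
    wassersteinOne c μ ν ≤ ∫⁻ p, c p.1 p.2 ∂D :=
  iInf_le_of_le D (iInf_le_of_le hfst (iInf_le _ hsnd))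

-- Couple the common part `m` along the diagonal and the excesses `μ`, `ν` independently.
lemma wassersteinOne_discreteMetric_add_le (m μ ν : Measure X) [IsFiniteMeasure ν]
    (h : μ Set.univ = ν Set.univ) :
    wassersteinOne discreteMetric (m + μ) (m + ν) ≤ ν Set.univ := by
  have : IsFiniteMeasure μ := ⟨h ▸ measure_lt_top ν _⟩
  rcases eq_or_ne (ν Set.univ) 0 with h0 | h0
  · rw [Measure.measure_univ_eq_zero.1 (h.trans h0), Measure.measure_univ_eq_zero.1 h0, add_zero]
    refine (wassersteinOne_le (m.map fun x => (x, x)) ?_ ?_).trans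
      ((lintegral_map_le _ _).trans (by simp [discreteMetric_self]))
    all_goals rw [Measure.map_map (by fun_prop) (by fun_prop)]; exact Measure.map_id
  have hcancel : (ν Set.univ)⁻¹ * ν Set.univ = 1 :=
    ENNReal.inv_mul_cancel h0 (measure_ne_top ν _)
  refine (wassersteinOne_le (m.map (fun x => (x, x)) + (ν Set.univ)⁻¹ • μ.prod ν) ?_ ?_).trans ?_
  · rw [Measure.map_add _ _ measurable_fst, Measure.map_smul, Measure.map_fst_prod, smul_smul,
      hcancel, one_smul, Measure.map_map measurable_fst (by fun_prop)]
    exact congrArg (· + μ) Measure.map_id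
  · rw [Measure.map_add _ _ measurable_snd, Measure.map_smul, Measure.map_snd_prod, h, smul_smul,
      hcancel, one_smul, Measure.map_map measurable_snd (by fun_prop)]
    exact congrArg (· + ν) Measure.map_id
  · have hdiag : ∫⁻ p, discreteMetric p.1 p.2 ∂(m.map fun x => (x, x)) ≤ 0 :=
      (lintegral_map_le _ _).trans (by simp [discreteMetric_self])
    have hprod : ∫⁻ p, discreteMetric p.1 p.2 ∂(μ.prod ν) ≤ ν Set.univ * ν Set.univ := by
      refine (lintegral_mono fun _ => discreteMetric_le_one _ _).trans_eq ?_
      rw [lintegral_one, ← Set.univ_prod_univ, Measure.prod_prod, h]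
    rw [lintegral_add_measure, lintegral_smul_measure, smul_eq_mul]
    calc _ ≤ 0 + (ν Set.univ)⁻¹ * (ν Set.univ * ν Set.univ) := by gcongr
      _ = ν Set.univ := by rw [zero_add, ← mul_assoc, hcancel, one_mul]

lemma wassersteinOne_discreteMetric_withDensity_le (ν : Measure X) [IsFiniteMeasure ν]
    {f : X → ℝ≥0∞} (hf : Measurable f) (hmass : ν.withDensity f Set.univ = ν Set.univ) :
    wassersteinOne discreteMetric (ν.withDensity f) ν ≤ ∫⁻ x, (1 - f x) ∂ν := by
  set m := ν.withDensity fun x => min (f x) 1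
  set excess := ν.withDensity fun x => f x - 1
  set defect := ν.withDensity fun x => 1 - f x
  have hexcess : m + excess = ν.withDensity f := by
    rw [← withDensity_add_left (by fun_prop)]
    exact congrArg _ (funext fun x => by simp [add_comm, tsub_add_min])
  have hdefect : m + defect = ν := by
    rw [← withDensity_add_left (by fun_prop)]
    conv_rhs => rw [← withDensity_one (μ := ν)]
    exact congrArg _ (funext fun x => by simp [min_comm (f x), add_comm, tsub_add_min])
  have hm : IsFiniteMeasure m := isFiniteMeasure_of_le ν (hdefect ▸ Measure.le_add_right le_rfl)
  have hd : IsFiniteMeasure defect :=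
    isFiniteMeasure_of_le ν (hdefect ▸ Measure.le_add_left le_rfl)
  have hmass' : excess Set.univ = defect Set.univ := by
    nth_rewrite 2 [← hdefect] at hmass
    rw [← hexcess, Measure.add_apply, Measure.add_apply] at hmass
    exact (ENNReal.add_right_inj (measure_ne_top m _)).1 hmass
  calc wassersteinOne discreteMetric (ν.withDensity f) ν
      = wassersteinOne discreteMetric (m + excess) (m + defect) := by rw [hexcess, hdefect]
    _ ≤ defect Set.univ := wassersteinOne_discreteMetric_add_le m excess defect hmass'
    _ = ∫⁻ x, (1 - f x) ∂ν := by rw [withDensity_apply _ .univ, Measure.restrict_univ]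

lemma mul_wassersteinOne_discreteMetric_le {μ ν : Measure X} [IsFiniteMeasure ν]
    (hmass : μ Set.univ = ν Set.univ) {c : ℝ≥0∞} (hc : c ≠ ∞) {g : X → ℝ≥0∞} (hg : Measurable g)
    (h : c • μ = ν.withDensity g) :
    c * wassersteinOne discreteMetric μ ν ≤ ∫⁻ x, (c - g x) ∂ν := by
  rcases eq_or_ne c 0 with rfl | hc0
  · simp
  have hμ : μ = ν.withDensity (c⁻¹ • g) := by
    rw [withDensity_smul _ hg, ← h, smul_smul, ENNReal.inv_mul_cancel hc0 hc, one_smul]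
  have hmass' : ν.withDensity (c⁻¹ • g) Set.univ = ν Set.univ := hμ ▸ hmass
  calc c * wassersteinOne discreteMetric μ ν
      ≤ c * ∫⁻ x, (1 - (c⁻¹ • g) x) ∂ν := by
        rw [hμ]
        gcongr
        exact wassersteinOne_discreteMetric_withDensity_le ν (hg.const_smul _) hmass'
    _ = ∫⁻ x, (c - g x) ∂ν := by
        rw [← lintegral_const_mul' _ _ hc]
        refine lintegral_congr fun x => ?_
        rw [ENNReal.mul_sub fun _ _ => hc, mul_one, Pi.smul_apply, smul_eq_mul, ← mul_assoc,
          ENNReal.mul_inv_cancel hc0 hc, one_mul]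

end Coupling

section Bayes

variable {Ω 𝓗 A V : Type*} [MeasurableSpace Ω] [MeasurableSpace 𝓗] [MeasurableSpace A]
  [MeasurableSpace V]

lemma withDensity_compProd {ν : Measure 𝓗} [SFinite ν] {κ : Kernel 𝓗 V} [IsSFiniteKernel κ]
    {q : 𝓗 → ℝ≥0∞} (hq : Measurable q) [IsSFiniteKernel (κ.withDensity fun h _ => q h)] :
    ν.withDensity q ⊗ₘ κ = ν ⊗ₘ κ.withDensity fun h _ => q h := by
  refine Measure.ext_of_lintegral _ fun F hF => ?_
  rw [Measure.lintegral_compProd hF, Measure.lintegral_compProd hF,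
    lintegral_withDensity_eq_lintegral_mul _ hq hF.lintegral_kernel_prod_right']
  refine lintegral_congr fun h => ?_
  rw [Kernel.lintegral_withDensity _ (by fun_prop) _ (by fun_prop),
    lintegral_const_mul _ (by fun_prop), Pi.mul_apply]

variable {μ : Measure Ω} [IsFiniteMeasure μ] {B : Ω → A} {H : Ω → 𝓗} {Y : Ω → V}

lemma map_restrict_preimage_eq_withDensity [StandardBorelSpace A] [Nonempty A]
    (hB : Measurable B) (hH : Measurable H) {s : Set A} (hs : MeasurableSet s) :
    (μ.restrict (B ⁻¹' s)).map H = (μ.map H).withDensity fun h => condDistrib B H μ h s := by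
  ext t ht
  rw [withDensity_apply _ ht, setLIntegral_map ht (Kernel.measurable_coe _ hs) hH,
    setLIntegral_preimage_condDistrib hH hB.aemeasurable hs ht, Measure.map_apply hH ht,
    Measure.restrict_apply (hH ht)]

variable [StandardBorelSpace V] [Nonempty V]

lemma map_restrict_preimage_singleton_eq_compProd [MeasurableSingletonClass A]
    (hB : Measurable B) (hH : Measurable H) (hY : Measurable Y) (a : A) :
    (μ.restrict (B ⁻¹' {a})).map (fun ω => (H ω, Y ω))
      = (μ.restrict (B ⁻¹' {a})).map H ⊗ₘ (condDistrib Y (fun ω => (B ω, H ω)) μ).sectR a := by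
  set κ := condDistrib Y (fun ω => (B ω, H ω)) μ
  have ha : MeasurableSet ({a} : Set A) := measurableSet_singleton a
  refine Measure.ext_of_lintegral _ fun F hF => ?_
  have hF' : Measurable fun p : (A × 𝓗) × V => F (p.1.2, p.2) := hF.comp (by fun_prop)
  calc ∫⁻ p, F p ∂(μ.restrict (B ⁻¹' {a})).map (fun ω => (H ω, Y ω))
      = ∫⁻ ω in (fun ω => ((B ω, H ω), Y ω)) ⁻¹' (({a} ×ˢ Set.univ) ×ˢ Set.univ),
          F (H ω, Y ω) ∂μ := by
        rw [lintegral_map hF (hH.prodMk hY)]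
        simp [Set.mk_preimage_prod]
    _ = ∫⁻ p in ({a} ×ˢ Set.univ) ×ˢ Set.univ, F (p.1.2, p.2)
          ∂(μ.map (fun ω => (B ω, H ω)) ⊗ₘ κ) := by
        rw [compProd_map_condDistrib hY.aemeasurable, setLIntegral_map
          ((ha.prod .univ).prod .univ) hF' ((hB.prodMk hH).prodMk hY)]
    _ = ∫⁻ ω in B ⁻¹' {a}, ∫⁻ y, F (H ω, y) ∂κ (B ω, H ω) ∂μ := by
        rw [Measure.setLIntegral_compProd hF' (ha.prod .univ) .univ]
        simp only [Measure.restrict_univ]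
        rw [setLIntegral_map (ha.prod .univ) hF'.lintegral_kernel_prod_right' (hB.prodMk hH)]
        simp [Set.mk_preimage_prod]
    _ = ∫⁻ ω in B ⁻¹' {a}, ∫⁻ y, F (H ω, y) ∂κ.sectR a (H ω) ∂μ :=
        setLIntegral_congr_fun (hB ha) fun ω (hω : B ω = a) => by simp [hω]
    _ = ∫⁻ p, F p ∂((μ.restrict (B ⁻¹' {a})).map H ⊗ₘ κ.sectR a) := by
        rw [Measure.lintegral_compProd hF, lintegral_map hF.lintegral_kernel_prod_right' hH]

variable [StandardBorelSpace A] [Nonempty A]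

lemma smul_condDistrib_ae_eq_withDensity (hB : Measurable B) (hH : Measurable H)
    (hY : Measurable Y) (a : A) :
    ∀ᵐ h ∂(μ.map H),
      condDistrib B H μ h {a} • condDistrib Y (fun ω => (B ω, H ω)) μ (a, h)
        = (condDistrib Y H μ h).withDensity
            fun y => condDistrib B (fun ω => (H ω, Y ω)) μ (h, y) {a} := by
  set q : 𝓗 → ℝ≥0∞ := fun h => condDistrib B H μ h {a}
  set g : 𝓗 → V → ℝ≥0∞ := fun h y => condDistrib B (fun ω => (H ω, Y ω)) μ (h, y) {a}
  set κ := (condDistrib Y (fun ω => (B ω, H ω)) μ).sectR a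
  have ha : MeasurableSet ({a} : Set A) := measurableSet_singleton a
  have hq : Measurable q := Kernel.measurable_coe _ ha
  have hg : Measurable (Function.uncurry g) := Kernel.measurable_coe _ ha
  have : IsFiniteKernel (κ.withDensity fun h _ => q h) :=
    Kernel.isFiniteKernel_withDensity_of_bounded κ ENNReal.one_ne_top fun _ _ => prob_le_one
  have : IsFiniteKernel ((condDistrib Y H μ).withDensity g) :=
    Kernel.isFiniteKernel_withDensity_of_bounded _ ENNReal.one_ne_top fun _ _ => prob_le_one
  have hjoint : μ.map H ⊗ₘ κ.withDensity (fun h _ => q h)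
      = μ.map H ⊗ₘ (condDistrib Y H μ).withDensity g :=
    calc μ.map H ⊗ₘ κ.withDensity (fun h _ => q h)
        = (μ.restrict (B ⁻¹' {a})).map H ⊗ₘ κ := by
          rw [map_restrict_preimage_eq_withDensity hB hH ha, withDensity_compProd hq]
      _ = (μ.restrict (B ⁻¹' {a})).map (fun ω => (H ω, Y ω)) :=
          (map_restrict_preimage_singleton_eq_compProd hB hH hY a).symm
      _ = (μ.map (fun ω => (H ω, Y ω))).withDensity (Function.uncurry g) :=
          map_restrict_preimage_eq_withDensity hB (hH.prodMk hY) ha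
      _ = μ.map H ⊗ₘ (condDistrib Y H μ).withDensity g := by
          rw [Measure.compProd_withDensity hg, compProd_map_condDistrib hY.aemeasurable]
          rfl
  filter_upwards [Kernel.ae_eq_of_compProd_eq hjoint] with h hh
  rwa [Kernel.withDensity_apply _ (by fun_prop), Kernel.withDensity_apply _ hg,
    withDensity_const] at hh

lemma setLIntegral_wassersteinOne_le (hB : Measurable B) (hH : Measurable H) (hY : Measurable Y)
    (a : A) :
    ∫⁻ ω in B ⁻¹' {a}, wassersteinOne discreteMetric
        (condDistrib Y (fun ω => (B ω, H ω)) μ (a, H ω)) (condDistrib Y H μ (H ω)) ∂μ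
      ≤ ∫⁻ ω, (condDistrib B H μ (H ω) {a}
          - condDistrib B (fun ω => (H ω, Y ω)) μ (H ω, Y ω) {a}) ∂μ := by
  set q : 𝓗 → ℝ≥0∞ := fun h => condDistrib B H μ h {a}
  set g : 𝓗 × V → ℝ≥0∞ := fun p => condDistrib B (fun ω => (H ω, Y ω)) μ p {a}
  set J : 𝓗 → ℝ≥0∞ := fun h => ∫⁻ y, (q h - g (h, y)) ∂(condDistrib Y H μ h)
  have ha : MeasurableSet ({a} : Set A) := measurableSet_singleton a
  have hq : Measurable q := Kernel.measurable_coe _ ha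
  have hg : Measurable g := Kernel.measurable_coe _ ha
  have hqtop : ∀ h, q h ≠ ∞ := fun h => measure_ne_top _ _
  have hJ : Measurable J := ((hq.comp measurable_fst).sub hg).lintegral_kernel_prod_right'
  have hJq : Measurable fun h => J h / q h := hJ.div hq
  have hdensity := map_restrict_preimage_eq_withDensity (μ := μ) hB hH ha
  have hW : ∀ᵐ h ∂((μ.restrict (B ⁻¹' {a})).map H), wassersteinOne discreteMetric
      (condDistrib Y (fun ω => (B ω, H ω)) μ (a, h)) (condDistrib Y H μ h) ≤ J h / q h := by
    rw [hdensity, ae_withDensity_iff hq]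
    filter_upwards [smul_condDistrib_ae_eq_withDensity (μ := μ) hB hH hY a] with h hh hq0
    rw [ENNReal.le_div_iff_mul_le (.inl hq0) (.inl (hqtop h)), mul_comm]
    exact mul_wassersteinOne_discreteMetric_le (by simp) (hqtop h) (by fun_prop) hh
  calc ∫⁻ ω in B ⁻¹' {a}, wassersteinOne discreteMetric
        (condDistrib Y (fun ω => (B ω, H ω)) μ (a, H ω)) (condDistrib Y H μ (H ω)) ∂μ
      ≤ ∫⁻ ω in B ⁻¹' {a}, J (H ω) / q (H ω) ∂μ :=
        lintegral_mono_ae (ae_of_ae_map hH.aemeasurable hW)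
    _ = ∫⁻ h, q h * (J h / q h) ∂(μ.map H) := by
        rw [← lintegral_map hJq hH, hdensity, lintegral_withDensity_eq_lintegral_mul _ hq hJq]
        rfl
    _ ≤ ∫⁻ h, J h ∂(μ.map H) := lintegral_mono fun h => ENNReal.mul_div_le
    _ = ∫⁻ ω, (q (H ω) - g (H ω, Y ω)) ∂μ := by
        rw [← Measure.lintegral_compProd (f := fun p => q p.1 - g p) (by fun_prop),
          compProd_map_condDistrib hY.aemeasurable, lintegral_map (by fun_prop) (hH.prodMk hY)]

end Bayes

section PostProb

variable {Ω 𝓗 V A : Type*} [MeasurableSpace Ω] [MeasurableSpace 𝓗] [MeasurableSpace V]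
  [MeasurableSpace A] [StandardBorelSpace A] [Nonempty A]
  {μ : Measure Ω} [IsFiniteMeasure μ] {B : Ω → A} {H : Ω → 𝓗} {Y : Ω → V} {a : A}

/-- The conditional probability `ℙ(B = a | H)`, as a random variable. -/
noncomputable def postProb (B : Ω → A) (H : Ω → 𝓗) (μ : Measure Ω) [IsFiniteMeasure μ] (a : A)
    (ω : Ω) : ℝ :=
  (condDistrib B H μ (H ω)).real {a}

lemma postProb_nonneg (ω : Ω) : 0 ≤ postProb B H μ a ω := measureReal_nonneg

lemma postProb_le_one (ω : Ω) : postProb B H μ a ω ≤ 1 := measureReal_le_one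

lemma measurable_condDistrib_real_singleton (a : A) :
    Measurable fun h => (condDistrib B H μ h).real {a} :=
  (Kernel.measurable_coe _ (measurableSet_singleton a)).ennreal_toReal

lemma measurable_postProb (hH : Measurable H) : Measurable (postProb B H μ a) :=
  (measurable_condDistrib_real_singleton a).comp hH

lemma integrable_postProb (hH : Measurable H) : Integrable (postProb B H μ a) μ :=
  .of_mem_Icc 0 1 (measurable_postProb hH).aemeasurable
    (.of_forall fun ω => ⟨postProb_nonneg ω, postProb_le_one ω⟩)

lemma integrable_postProb_mul_inv (hH : Measurable H) {w : 𝓗 → ℝ} (hw : Measurable w)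
    (hpw : ∀ h, 0 ≤ w h ∧ (condDistrib B H μ h).real {a} ≤ w h) :
    Integrable (fun ω => postProb B H μ a ω * (w (H ω))⁻¹) μ :=
  .of_mem_Icc 0 1 ((measurable_postProb hH).mul (hw.inv.comp hH)).aemeasurable
    (.of_forall fun ω => ⟨mul_nonneg (postProb_nonneg ω) (inv_nonneg.2 (hpw _).1),
      mul_inv_le_one_of_le₀ (hpw _).2 (hpw _).1⟩)

lemma sum_postProb [Fintype A] (B : Ω → A) (H : Ω → 𝓗) (ω : Ω) : ∑ b, postProb B H μ b ω = 1 :=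
  sum_measureReal_singleton Finset.univ |>.trans (by simp)

lemma integrable_postProb_mul_iff (hB : Measurable B) (hH : Measurable H) {f : 𝓗 → ℝ}
    (hf : Measurable f) :
    Integrable (fun ω => postProb B H μ a ω * f (H ω)) μ
      ↔ IntegrableOn (fun ω => f (H ω)) (B ⁻¹' {a}) μ := by
  have ha : MeasurableSet ({a} : Set A) := measurableSet_singleton a
  rw [IntegrableOn, ← Function.comp_def f H,
    ← integrable_map_measure hf.aestronglyMeasurable hH.aemeasurable,
    map_restrict_preimage_eq_withDensity hB hH ha,
    integrable_withDensity_iff_integrable_smul' (Kernel.measurable_coe _ ha)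
      (.of_forall fun h => measure_lt_top _ _)]
  exact (integrable_map_measure ((measurable_condDistrib_real_singleton a).mul
    hf).aestronglyMeasurable hH.aemeasurable).symm

lemma integral_postProb_mul (hB : Measurable B) (hH : Measurable H) {f : 𝓗 → ℝ}
    (hf : Measurable f) :
    ∫ ω, postProb B H μ a ω * f (H ω) ∂μ = ∫ ω in B ⁻¹' {a}, f (H ω) ∂μ := by
  have ha : MeasurableSet ({a} : Set A) := measurableSet_singleton a
  rw [← integral_map (φ := H) hH.aemeasurable hf.aestronglyMeasurable,
    map_restrict_preimage_eq_withDensity hB hH ha,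
    integral_withDensity_eq_integral_toReal_smul (Kernel.measurable_coe _ ha)
      (.of_forall fun h => measure_lt_top _ _)]
  exact (integral_map hH.aemeasurable
    ((measurable_condDistrib_real_singleton a).mul hf).aestronglyMeasurable).symm

lemma integrable_postProb_prodMk_mul (hB : Measurable B) (hH : Measurable H) (hY : Measurable Y)
    {f : 𝓗 → ℝ} (hf : Measurable f)
    (hint : Integrable (fun ω => postProb B H μ a ω * f (H ω)) μ) :
    Integrable (fun ω => postProb B (fun ω => (H ω, Y ω)) μ a ω * f (H ω)) μ :=
  (integrable_postProb_mul_iff hB (hH.prodMk hY) (hf.comp measurable_fst)).2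
    ((integrable_postProb_mul_iff hB hH hf).1 hint)

lemma integral_postProb_prodMk_mul (hB : Measurable B) (hH : Measurable H) (hY : Measurable Y)
    {f : 𝓗 → ℝ} (hf : Measurable f) :
    ∫ ω, postProb B (fun ω => (H ω, Y ω)) μ a ω * f (H ω) ∂μ
      = ∫ ω, postProb B H μ a ω * f (H ω) ∂μ :=
  (integral_postProb_mul hB (hH.prodMk hY) (hf.comp measurable_fst)).trans
    (integral_postProb_mul hB hH hf).symm

lemma integral_postProb_sub_prodMk (hB : Measurable B) (hH : Measurable H) (hY : Measurable Y) :
    ∫ ω, postProb B H μ a ω - postProb B (fun ω => (H ω, Y ω)) μ a ω ∂μ = 0 := by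
  rw [integral_sub (integrable_postProb hH) (integrable_postProb (hH.prodMk hY)), sub_eq_zero]
  simpa using (integral_postProb_prodMk_mul hB hH hY measurable_const (f := fun _ => 1)).symm

lemma postProb_prodMk_eq_zero_of_eq_zero (hB : Measurable B) (hH : Measurable H)
    (hY : Measurable Y) :
    ∀ᵐ ω ∂μ, postProb B H μ a ω = 0 → postProb B (fun ω => (H ω, Y ω)) μ a ω = 0 := by
  set f : 𝓗 → ℝ := fun h => if (condDistrib B H μ h).real {a} = 0 then 1 else 0
  have hf : Measurable f := .ite (measurableSet_eq_fun (measurable_condDistrib_real_singleton a)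
    measurable_const) measurable_const measurable_const
  have hf_nonneg : ∀ h, 0 ≤ f h := fun h => by simp only [f]; split_ifs <;> simp
  have hprior : ∀ ω, postProb B H μ a ω * f (H ω) = 0 := fun ω => by
    simp +contextual [f, postProb]
  have hint := integrable_postProb_prodMk_mul hB hH hY hf (a := a) (μ := μ) (by simp [hprior])
  have hzero := integral_postProb_prodMk_mul hB hH hY hf (a := a) (μ := μ)
  simp only [hprior, integral_zero] at hzero
  filter_upwards [(integral_eq_zero_iff_of_nonneg
    (fun ω => mul_nonneg (postProb_nonneg ω) (hf_nonneg _)) hint).1 hzero] with ω hω h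
  have hfω : f (H ω) = 1 := if_pos h
  simpa [hfω] using hω

end PostProb

section Entropy

lemma negMulLog_mem_Icc {x : ℝ} (hx : x ∈ Set.Icc (0 : ℝ) 1) :
    Real.negMulLog x ∈ Set.Icc (0 : ℝ) 1 := by
  refine ⟨Real.negMulLog_nonneg hx.1 hx.2, ?_⟩
  have h := InformationTheory.klFun_nonneg hx.1
  rw [InformationTheory.klFun_apply] at h
  rw [Real.negMulLog]
  linarith [hx.1]

variable {Ω 𝓗 V A : Type*} [MeasurableSpace Ω] [MeasurableSpace 𝓗] [MeasurableSpace V]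
  [MeasurableSpace A]

/-- The Shannon entropy, in nats, of a law on a finite set. -/
noncomputable def shannonEntropy [Fintype A] (ν : Measure A) : ℝ :=
  ∑ a, Real.negMulLog (ν.real {a})

lemma shannonEntropy_nonneg [Fintype A] (ν : Measure A) [IsProbabilityMeasure ν] :
    0 ≤ shannonEntropy ν :=
  Finset.sum_nonneg fun _ _ => Real.negMulLog_nonneg measureReal_nonneg measureReal_le_one

variable [StandardBorelSpace A] [Nonempty A] {μ : Measure Ω} [IsFiniteMeasure μ] {B : Ω → A}
  {H : Ω → 𝓗} {Y : Ω → V} {w : 𝓗 → ℝ} {a : A}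

/-- The conditional Shannon entropy `H(B | H)` of a finitely valued `B`. -/
noncomputable def condEntropy [Fintype A] (B : Ω → A) (H : Ω → 𝓗) (μ : Measure Ω)
    [IsFiniteMeasure μ] : ℝ :=
  ∫ ω, shannonEntropy (condDistrib B H μ (H ω)) ∂μ

lemma condEntropy_nonneg [Fintype A] : 0 ≤ condEntropy B H μ :=
  integral_nonneg fun _ => shannonEntropy_nonneg _

lemma integrable_mul_of_mem_Icc {f g : Ω → ℝ} (hf : Measurable f) (hg : Measurable g)
    (hf01 : ∀ ω, f ω ∈ Set.Icc (0 : ℝ) 1) (hg01 : ∀ ω, g ω ∈ Set.Icc (0 : ℝ) 1) :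
    Integrable (fun ω => f ω * g ω) μ :=
  .of_mem_Icc 0 1 (hf.mul hg).aemeasurable (.of_forall fun ω =>
    ⟨mul_nonneg (hf01 ω).1 (hg01 ω).1, mul_le_one₀ (hf01 ω).2 (hg01 ω).1 (hg01 ω).2⟩)

lemma integrable_mul_negMulLog_postProb (hH : Measurable H) {f : Ω → ℝ} (hf : Measurable f)
    (hf01 : ∀ ω, f ω ∈ Set.Icc (0 : ℝ) 1) :
    Integrable (fun ω => f ω * Real.negMulLog (postProb B H μ a ω)) μ :=
  integrable_mul_of_mem_Icc hf (Real.continuous_negMulLog.measurable.comp (measurable_postProb hH))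
    hf01 fun ω => negMulLog_mem_Icc ⟨postProb_nonneg ω, postProb_le_one ω⟩

lemma measurable_shannonEntropy_condDistrib [Fintype A] :
    Measurable fun h => shannonEntropy (condDistrib B H μ h) :=
  Finset.measurable_sum _ fun b _ =>
    Real.continuous_negMulLog.measurable.comp (measurable_condDistrib_real_singleton b)

lemma integrable_mul_shannonEntropy [Fintype A] (hH : Measurable H) {f : Ω → ℝ}
    (hf : Measurable f) (hf01 : ∀ ω, f ω ∈ Set.Icc (0 : ℝ) 1) :
    Integrable (fun ω => f ω * shannonEntropy (condDistrib B H μ (H ω))) μ := by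
  simp only [shannonEntropy, Finset.mul_sum]
  exact integrable_finsetSum _ fun b _ => integrable_mul_negMulLog_postProb hH hf hf01

lemma integral_mul_shannonEntropy [Fintype A] (hH : Measurable H) {f : Ω → ℝ} (hf : Measurable f)
    (hf01 : ∀ ω, f ω ∈ Set.Icc (0 : ℝ) 1) :
    ∫ ω, f ω * shannonEntropy (condDistrib B H μ (H ω)) ∂μ
      = ∑ b, ∫ ω, f ω * Real.negMulLog (postProb B H μ b ω) ∂μ := by
  rw [← integral_finsetSum _ fun b _ => integrable_mul_negMulLog_postProb hH hf hf01]
  simp only [shannonEntropy, Finset.mul_sum, postProb]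

variable (hB : Measurable B) (hH : Measurable H) (hY : Measurable Y) (hw : Measurable w)
  (hw01 : ∀ h, w h ∈ Set.Icc (0 : ℝ) 1)

include hB hH hY hw hw01

lemma integrable_and_integral_mul_klTerm_postProb :
    Integrable (fun ω => w (H ω)
      * klTerm (postProb B (fun ω => (H ω, Y ω)) μ a ω) (postProb B H μ a ω)) μ ∧
    ∫ ω, w (H ω) * klTerm (postProb B (fun ω => (H ω, Y ω)) μ a ω) (postProb B H μ a ω) ∂μ
      = ∫ ω, w (H ω) * Real.negMulLog (postProb B H μ a ω) ∂μ
        - ∫ ω, w (H ω) * Real.negMulLog (postProb B (fun ω => (H ω, Y ω)) μ a ω) ∂μ := by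
  set x := postProb B (fun ω => (H ω, Y ω)) μ a
  set p := postProb B H μ a
  set logp : 𝓗 → ℝ := fun h => w h * Real.log ((condDistrib B H μ h).real {a})
  have hwH : Measurable fun ω => w (H ω) := hw.comp hH
  have hlogp : Measurable logp := hw.mul (measurable_condDistrib_real_singleton a).log
  have hlogp_apply : ∀ ω, logp (H ω) = w (H ω) * Real.log (p ω) := fun ω => rfl
  have hp_log : ∀ ω, p ω * logp (H ω) = -(w (H ω) * Real.negMulLog (p ω)) := fun ω => by
    rw [hlogp_apply, Real.negMulLog]
    ring
  have hexpand : ∀ᵐ ω ∂μ, w (H ω) * klTerm (x ω) (p ω)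
      = p ω * w (H ω) - w (H ω) * Real.negMulLog (x ω) - x ω * logp (H ω) - x ω * w (H ω) := by
    filter_upwards [postProb_prodMk_eq_zero_of_eq_zero (a := a) (μ := μ) hB hH hY] with ω hω
    rw [klTerm_eq hω, hlogp_apply]
    ring
  have hpint : Integrable (fun ω => p ω * w (H ω)) μ := integrable_mul_of_mem_Icc
    (measurable_postProb hH) hwH (fun ω => ⟨postProb_nonneg ω, postProb_le_one ω⟩) fun ω => hw01 _
  have hxint : Integrable (fun ω => x ω * w (H ω)) μ :=
    integrable_postProb_prodMk_mul hB hH hY hw hpint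
  have hxlog : Integrable (fun ω => x ω * logp (H ω)) μ :=
    integrable_postProb_prodMk_mul hB hH hY hlogp ((integrable_mul_negMulLog_postProb (a := a)
      hH hwH fun ω => hw01 _).neg.congr (.of_forall fun ω => (hp_log ω).symm))
  have hxent : Integrable (fun ω => w (H ω) * Real.negMulLog (x ω)) μ :=
    integrable_mul_negMulLog_postProb (hH.prodMk hY) hwH fun ω => hw01 _
  have hpx : Integrable (fun ω => p ω * w (H ω) - w (H ω) * Real.negMulLog (x ω)) μ :=
    hpint.sub hxent
  have hpxl : Integrable (fun ω => p ω * w (H ω) - w (H ω) * Real.negMulLog (x ω)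
      - x ω * logp (H ω)) μ := hpx.sub hxlog
  refine ⟨(hpxl.sub hxint).congr (hexpand.mono fun ω h => h.symm), ?_⟩
  rw [integral_congr_ae hexpand, integral_sub hpxl hxint, integral_sub hpx hxlog,
    integral_sub hpint hxent, integral_postProb_prodMk_mul hB hH hY hlogp,
    integral_postProb_prodMk_mul hB hH hY hw, integral_congr_ae (.of_forall hp_log), integral_neg]
  ring

lemma integral_posPart_postProb_sub_le (hpw : ∀ h, (condDistrib B H μ h).real {a} ≤ w h)
    {l : ℝ} (hl : 0 < l) :
    ∫ ω, (postProb B H μ a ω - postProb B (fun ω => (H ω, Y ω)) μ a ω)⁺ ∂μ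
      ≤ l / 2 * ∫ ω, w (H ω)
            * klTerm (postProb B (fun ω => (H ω, Y ω)) μ a ω) (postProb B H μ a ω) ∂μ
        + (∫ ω, postProb B H μ a ω * (w (H ω))⁻¹ ∂μ) / (4 * l) := by
  set x := postProb B (fun ω => (H ω, Y ω)) μ a
  set p := postProb B H μ a
  have hinv : Measurable fun h => (w h)⁻¹ := hw.inv
  have hpw_int : Integrable (fun ω => p ω * (w (H ω))⁻¹) μ :=
    integrable_postProb_mul_inv hH hw fun h => ⟨(hw01 h).1, hpw h⟩
  have hxw_int : Integrable (fun ω => x ω * (w (H ω))⁻¹) μ :=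
    integrable_postProb_prodMk_mul hB hH hY hinv hpw_int
  have hdiff : Integrable (fun ω => p ω - x ω) μ :=
    (integrable_postProb hH).sub (integrable_postProb (hH.prodMk hY))
  have hkl := (integrable_and_integral_mul_klTerm_postProb (μ := μ) (a := a) hB hH hY hw hw01).1
  have hlin : Integrable (fun ω => (p ω - x ω) / 2 + l / 2 * (w (H ω) * klTerm (x ω) (p ω))) μ :=
    (hdiff.div_const 2).add (hkl.const_mul (l / 2))
  have hratio : Integrable (fun ω => x ω * (w (H ω))⁻¹ + 2 * (p ω * (w (H ω))⁻¹)) μ :=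
    hxw_int.add (hpw_int.const_mul 2)
  have hpointwise : ∀ᵐ ω ∂μ, (p ω - x ω)⁺ ≤ (p ω - x ω) / 2
      + l / 2 * (w (H ω) * klTerm (x ω) (p ω))
      + (x ω * (w (H ω))⁻¹ + 2 * (p ω * (w (H ω))⁻¹)) / (12 * l) := by
    filter_upwards [postProb_prodMk_eq_zero_of_eq_zero (a := a) (μ := μ) hB hH hY]
      with ω (hω : p ω = 0 → x ω = 0)
    exact posPart_sub_le_mul_klTerm (postProb_nonneg ω) (postProb_nonneg ω) hω (hpw _) hl
  calc ∫ ω, (p ω - x ω)⁺ ∂μ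
      ≤ ∫ ω, ((p ω - x ω) / 2 + l / 2 * (w (H ω) * klTerm (x ω) (p ω))
          + (x ω * (w (H ω))⁻¹ + 2 * (p ω * (w (H ω))⁻¹)) / (12 * l)) ∂μ :=
        integral_mono_ae hdiff.pos_part (hlin.add (hratio.div_const _)) hpointwise
    _ = (∫ ω, p ω - x ω ∂μ) / 2 + l / 2 * ∫ ω, w (H ω) * klTerm (x ω) (p ω) ∂μ
          + (∫ ω, x ω * (w (H ω))⁻¹ ∂μ + 2 * ∫ ω, p ω * (w (H ω))⁻¹ ∂μ) / (12 * l) := by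
        rw [integral_add hlin (hratio.div_const _),
          integral_add (hdiff.div_const _) (hkl.const_mul _), integral_div, integral_div,
          integral_const_mul, integral_add hxw_int (hpw_int.const_mul 2), integral_const_mul]
    _ = l / 2 * ∫ ω, w (H ω) * klTerm (x ω) (p ω) ∂μ
          + (∫ ω, p ω * (w (H ω))⁻¹ ∂μ) / (4 * l) := by
        rw [integral_postProb_sub_prodMk hB hH hY, integral_postProb_prodMk_mul hB hH hY hinv]
        ring

end Entropy

section SamplingGain

variable {Ω 𝓗 V A : Type*} [MeasurableSpace Ω] [MeasurableSpace 𝓗] [MeasurableSpace V]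
  [Fintype A] [MeasurableSpace A] [StandardBorelSpace A] [Nonempty A]

/-- The expected total variation distance between the laws of `Y_B` given `(B, H)` and given `H`
(with the index of the component frozen at the value of `B`), expressed through Bayes' rule in terms
of the posteriors of `B`. -/
noncomputable def expectedTV (B : Ω → A) (H : Ω → 𝓗) (Y : A → Ω → V) (μ : Measure Ω)
    [IsFiniteMeasure μ] : ℝ :=
  ∑ a, ∫ ω, (postProb B H μ a ω - postProb B (fun ω => (H ω, Y a ω)) μ a ω)⁺ ∂μ

/-- The information about `B` gained from the observation `Y_c` given `H`, when the index `c` is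
drawn from the posterior of `B` given `H`. -/
noncomputable def samplingGain (B : Ω → A) (H : Ω → 𝓗) (Y : A → Ω → V) (μ : Measure Ω)
    [IsFiniteMeasure μ] : ℝ :=
  ∑ c, ∑ b, ∫ ω, postProb B H μ c ω
    * klTerm (postProb B (fun ω => (H ω, Y c ω)) μ b ω) (postProb B H μ b ω) ∂μ

variable {B : Ω → A} {H : Ω → 𝓗} {Y : A → Ω → V} (hB : Measurable B) (hH : Measurable H)
  (hY : ∀ a, Measurable (Y a))

include hB hH hY

lemma lintegral_wassersteinOne_le_expectedTV [StandardBorelSpace V] [Nonempty V] {μ : Measure Ω}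
    [IsFiniteMeasure μ] :
    ∫⁻ ω, wassersteinOne discreteMetric
        (condDistrib (Y (B ω)) (fun ω => (B ω, H ω)) μ (B ω, H ω))
        (condDistrib (Y (B ω)) H μ (H ω)) ∂μ
      ≤ ENNReal.ofReal (expectedTV B H Y μ) := by
  have hcover : ⋃ a, B ⁻¹' {a} = Set.univ := by
    rw [← Set.preimage_iUnion, Set.iUnion_of_singleton, Set.preimage_univ]
  rw [← setLIntegral_univ, ← hcover, lintegral_iUnion (fun a => hB (measurableSet_singleton a))
    (fun a b hab => Disjoint.preimage _ (by simpa)), tsum_fintype, expectedTV,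
    ENNReal.ofReal_sum_of_nonneg fun a _ => integral_nonneg fun ω => posPart_nonneg _]
  refine Finset.sum_le_sum fun a _ => ?_
  have hint : Integrable
      (fun ω => (postProb B H μ a ω - postProb B (fun ω => (H ω, Y a ω)) μ a ω)⁺) μ :=
    ((integrable_postProb hH).sub (integrable_postProb (hH.prodMk (hY a)))).pos_part
  rw [ofReal_integral_eq_lintegral_ofReal hint (.of_forall fun ω => posPart_nonneg _),
    setLIntegral_congr_fun (hB (measurableSet_singleton a))
      (g := fun ω => wassersteinOne discreteMetric
        (condDistrib (Y a) (fun ω => (B ω, H ω)) μ (a, H ω)) (condDistrib (Y a) H μ (H ω)))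
      fun ω (hω : B ω = a) => by simp only [hω]]
  refine (setLIntegral_wassersteinOne_le hB hH (hY a) a).trans_eq (lintegral_congr fun ω => ?_)
  rw [posPart_def, ENNReal.ofReal_max, ENNReal.ofReal_zero, max_eq_left zero_le, postProb, postProb,
    ENNReal.ofReal_sub _ measureReal_nonneg, ofReal_measureReal, ofReal_measureReal]

lemma samplingGain_eq_condEntropy_sub {μ : Measure Ω} [IsFiniteMeasure μ] :
    samplingGain B H Y μ = condEntropy B H μ - ∑ c, ∫ ω, postProb B H μ c ω
      * shannonEntropy (condDistrib B (fun ω => (H ω, Y c ω)) μ (H ω, Y c ω)) ∂μ := by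
  have hp01 (c : A) (ω : Ω) : postProb B H μ c ω ∈ Set.Icc (0 : ℝ) 1 :=
    ⟨postProb_nonneg ω, postProb_le_one ω⟩
  have hprior : condEntropy B H μ
      = ∑ c, ∫ ω, postProb B H μ c ω * shannonEntropy (condDistrib B H μ (H ω)) ∂μ := by
    rw [← integral_finsetSum _ fun c _ => integrable_mul_shannonEntropy hH
      (measurable_postProb hH) (hp01 c)]
    simp only [condEntropy, ← Finset.sum_mul, sum_postProb, one_mul]
  rw [hprior, ← Finset.sum_sub_distrib, samplingGain]
  refine Finset.sum_congr rfl fun c _ => ?_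
  rw [integral_mul_shannonEntropy hH (measurable_postProb hH) (hp01 c),
    integral_mul_shannonEntropy (hH.prodMk (hY c)) (measurable_postProb hH) (hp01 c),
    ← Finset.sum_sub_distrib]
  exact Finset.sum_congr rfl fun b _ => (integrable_and_integral_mul_klTerm_postProb hB hH (hY c)
    (measurable_condDistrib_real_singleton c) fun _ => ⟨measureReal_nonneg, measureReal_le_one⟩).2

variable {μ : Measure Ω} [IsProbabilityMeasure μ] {l : ℝ}

lemma expectedTV_le_samplingGain_add_card (hl : 0 < l) :
    expectedTV B H Y μ ≤ l / 2 * samplingGain B H Y μ + Fintype.card A / (4 * l) := by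
  have hterm (a : A) : ∫ ω, (postProb B H μ a ω - postProb B (fun ω => (H ω, Y a ω)) μ a ω)⁺ ∂μ
      ≤ l / 2 * ∑ b, ∫ ω, postProb B H μ a ω
          * klTerm (postProb B (fun ω => (H ω, Y a ω)) μ b ω) (postProb B H μ b ω) ∂μ
        + 1 / (4 * l) := by
    refine (integral_posPart_postProb_sub_le hB hH (hY a) (measurable_condDistrib_real_singleton a)
      (fun _ => ⟨measureReal_nonneg, measureReal_le_one⟩) (fun _ => le_rfl) hl).trans ?_
    gcongr
    · exact Finset.single_le_sum (f := fun b => ∫ ω, postProb B H μ a ω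
          * klTerm (postProb B (fun ω => (H ω, Y a ω)) μ b ω) (postProb B H μ b ω) ∂μ)
        (fun b _ => integral_nonneg fun ω => mul_nonneg (postProb_nonneg ω)
          (klTerm_nonneg (postProb_nonneg ω) (postProb_nonneg ω))) (Finset.mem_univ a)
    · calc ∫ ω, postProb B H μ a ω * (postProb B H μ a ω)⁻¹ ∂μ ≤ ∫ _, 1 ∂μ :=
            integral_mono_of_nonneg (.of_forall fun ω => mul_nonneg (postProb_nonneg ω)
              (inv_nonneg.2 (postProb_nonneg ω))) (integrable_const _)
              (.of_forall fun _ => mul_inv_le_one)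
        _ = 1 := by simp
  refine (Finset.sum_le_sum fun a _ => hterm a).trans_eq ?_
  rw [Finset.sum_add_distrib, ← Finset.mul_sum, samplingGain]
  simp [div_eq_mul_inv]

lemma expectedTV_le_samplingGain_add_one (hl : 0 < l)
    (hinfo : ∀ a b c, postProb B (fun ω => (H ω, Y a ω)) μ b
      =ᵐ[μ] postProb B (fun ω => (H ω, Y c ω)) μ b) :
    expectedTV B H Y μ ≤ l / 2 * samplingGain B H Y μ + 1 / (4 * l) := by
  have hterm (a : A) : ∫ ω, (postProb B H μ a ω - postProb B (fun ω => (H ω, Y a ω)) μ a ω)⁺ ∂μ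
      ≤ l / 2 * ∫ ω, klTerm (postProb B (fun ω => (H ω, Y a ω)) μ a ω) (postProb B H μ a ω) ∂μ
        + (∫ ω, postProb B H μ a ω ∂μ) / (4 * l) := by
    simpa using integral_posPart_postProb_sub_le hB hH (hY a) (w := fun _ => 1) measurable_const
      (by simp) (fun _ => measureReal_le_one) hl
  have hgain (a : A) :
      ∫ ω, klTerm (postProb B (fun ω => (H ω, Y a ω)) μ a ω) (postProb B H μ a ω) ∂μ
        = ∑ c, ∫ ω, postProb B H μ c ω
            * klTerm (postProb B (fun ω => (H ω, Y c ω)) μ a ω) (postProb B H μ a ω) ∂μ := by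
    have hint (c : A) : Integrable (fun ω => postProb B H μ c ω
        * klTerm (postProb B (fun ω => (H ω, Y c ω)) μ a ω) (postProb B H μ a ω)) μ :=
      (integrable_and_integral_mul_klTerm_postProb hB hH (hY c)
        (measurable_condDistrib_real_singleton c)
        fun _ => ⟨measureReal_nonneg, measureReal_le_one⟩).1
    rw [← integral_finsetSum _ fun c _ => hint c]
    refine integral_congr_ae ?_
    filter_upwards [ae_all_iff.2 fun c => hinfo c a a] with ω hω
    simp only [hω, ← Finset.sum_mul, sum_postProb, one_mul]
  refine (Finset.sum_le_sum fun a _ => hterm a).trans_eq ?_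
  rw [Finset.sum_add_distrib, ← Finset.mul_sum, ← Finset.sum_div,
    ← integral_finsetSum _ fun a _ => integrable_postProb hH, samplingGain, Finset.sum_comm]
  simp only [hgain, sum_postProb]
  simp

end SamplingGain

section Sampling

variable {Ω Ω' 𝓗 𝓩 V A : Type*} [MeasurableSpace Ω] [MeasurableSpace Ω'] [MeasurableSpace 𝓗]
  [MeasurableSpace 𝓩] [MeasurableSpace V] [MeasurableSpace A] {μ : Measure Ω} [IsFiniteMeasure μ]
  {B : Ω → A} {H : Ω → 𝓗} {Z : Ω → 𝓩} {Y : A → Ω → V}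

lemma measurable_observation [Countable A] [MeasurableSingletonClass A] (hH : Measurable H)
    (hY : ∀ a, Measurable (Y a)) : Measurable fun p : Ω × A => (H p.1, p.2, Y p.2 p.1) :=
  (hH.comp measurable_fst).prodMk (measurable_snd.prodMk (measurable_from_prod_countable_left hY))

lemma lintegral_compProd_comap [Countable A] [MeasurableSingletonClass A]
    (hH : Measurable H) {κ : Kernel 𝓗 A} [IsFiniteKernel κ]
    {f : Ω × A → ℝ≥0∞} (hf : Measurable f) :
    ∫⁻ p, f p ∂(μ ⊗ₘ κ.comap H hH) = ∑' a, ∫⁻ ω, f (ω, a) * κ (H ω) {a} ∂μ := by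
  have hterm (a : A) : Measurable fun ω => f (ω, a) * κ (H ω) {a} :=
    (hf.comp measurable_prodMk_right).mul
      ((Kernel.measurable_coe κ (measurableSet_singleton a)).comp hH)
  rw [Measure.lintegral_compProd hf, ← lintegral_tsum fun a => (hterm a).aemeasurable]
  simp only [Kernel.comap_apply, lintegral_countable']

variable [StandardBorelSpace A] [Nonempty A]

lemma lintegral_lintegral_condDistrib (hB : Measurable B) (hH : Measurable H)
    {F : 𝓗 × A → ℝ≥0∞} (hF : Measurable F) :
    ∫⁻ ω, ∫⁻ b, F (H ω, b) ∂condDistrib B H μ (H ω) ∂μ = ∫⁻ ω, F (H ω, B ω) ∂μ := by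
  rw [← lintegral_map hF (hH.prodMk hB), ← compProd_map_condDistrib hB.aemeasurable,
    Measure.lintegral_compProd hF, lintegral_map hF.lintegral_kernel_prod_right' hH]

lemma condDistrib_comp_ae_eq_of_lintegral_eq (hB : Measurable B) (hH : Measurable H)
    {κ : Kernel 𝓗 A} [IsFiniteKernel κ] (h : ∀ F : 𝓗 × A → ℝ≥0∞, Measurable F →
      ∫⁻ ω, F (H ω, B ω) ∂μ = ∫⁻ ω, ∫⁻ b, F (H ω, b) ∂κ (H ω) ∂μ) :
    ∀ᵐ ω ∂μ, condDistrib B H μ (H ω) = κ (H ω) := by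
  refine ae_of_ae_map hH.aemeasurable (condDistrib_ae_eq_of_measure_eq_compProd H hB.aemeasurable
    (Measure.ext_of_lintegral _ fun F hF => ?_))
  rw [lintegral_map hF (hH.prodMk hB), Measure.lintegral_compProd hF,
    lintegral_map hF.lintegral_kernel_prod_right' hH, h F hF]

lemma condDistrib_comp_ae_eq_of_equiv (hB : Measurable B) (hZ : Measurable Z) {φ : 𝓗 → 𝓩}
    {ψ : 𝓩 → 𝓗} (hφ : Measurable φ) (hψ : Measurable ψ) (hH : ∀ ω, H ω = ψ (Z ω))
    (hZH : ∀ᵐ ω ∂μ, Z ω = φ (H ω)) :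
    ∀ᵐ ω ∂μ, condDistrib B H μ (H ω) = condDistrib B Z μ (Z ω) := by
  have hHmeas : Measurable H := (funext hH : H = ψ ∘ Z) ▸ hψ.comp hZ
  have h := condDistrib_comp_ae_eq_of_lintegral_eq (μ := μ) hB hHmeas
    (κ := (condDistrib B Z μ).comap φ hφ) fun F hF => by
      calc ∫⁻ ω, F (H ω, B ω) ∂μ
          = ∫⁻ ω, ∫⁻ b, F (ψ (Z ω), b) ∂condDistrib B Z μ (Z ω) ∂μ := by
            rw [lintegral_lintegral_condDistrib (F := fun p => F (ψ p.1, p.2)) hB hZ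
              (by fun_prop)]
            simp only [hH]
        _ = ∫⁻ ω, ∫⁻ b, F (H ω, b) ∂(condDistrib B Z μ).comap φ hφ (H ω) ∂μ := by
            refine lintegral_congr_ae (hZH.mono fun ω hω => ?_)
            beta_reduce
            rw [← hH, Kernel.comap_apply, ← hω]
  filter_upwards [h, hZH] with ω hω hZω
  rw [hω, Kernel.comap_apply, ← hZω]

lemma condDistrib_comp_measurePreserving_ae_eq {X : Type*} [MeasurableSpace X]
    [StandardBorelSpace X] [Nonempty X] {f : Ω' → Ω} {ν : Measure Ω'} [IsFiniteMeasure ν]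
    {Θ : Ω → X} {γ : X → A} (hf : MeasurePreserving f ν μ) (hΘ : Measurable Θ) (hH : Measurable H)
    (hγ : Measurable γ) :
    ∀ᵐ ω ∂μ, condDistrib (fun ω => γ (Θ (f ω))) (fun ω => H (f ω)) ν (H ω)
      = (condDistrib Θ H μ (H ω)).map γ := by
  obtain ⟨hf, rfl⟩ := hf
  have hcomp := condDistrib_comp (μ := ν.map f) (mβ := ‹_›) H hΘ.aemeasurable hγ
  have hmap := condDistrib_map (ν := ν) hH.aemeasurable (hγ.comp hΘ).aemeasurable hf.aemeasurable
  rw [← Measure.map_map hH hf] at hmap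
  filter_upwards [ae_of_ae_map hH.aemeasurable (hmap.symm.trans hcomp)] with ω hω
  exact hω.trans (Kernel.map_apply _ hγ _)

lemma condDistrib_compProd_ae_eq [Countable A] (hB : Measurable B) (hH : Measurable H)
    (hY : ∀ a, Measurable (Y a)) (κ : Kernel 𝓗 A) [IsFiniteKernel κ] :
    ∀ᵐ p ∂(μ ⊗ₘ κ.comap H hH),
      condDistrib (fun p => B p.1) (fun p => (H p.1, p.2, Y p.2 p.1)) (μ ⊗ₘ κ.comap H hH)
          (H p.1, p.2, Y p.2 p.1)
        = condDistrib B (fun ω => (H ω, Y p.2 ω)) μ (H p.1, Y p.2 p.1) := by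
  have hobs := measurable_observation hH hY
  have hη : Measurable fun q : (𝓗 × V) × A => condDistrib B (fun ω => (H ω, Y q.2 ω)) μ q.1 :=
    measurable_from_prod_countable_left fun a =>
      Kernel.measurable (condDistrib B (fun ω => (H ω, Y a ω)) μ)
  let η : Kernel (𝓗 × A × V) A :=
    ⟨fun z => condDistrib B (fun ω => (H ω, Y z.2.1 ω)) μ (z.1, z.2.2),
      hη.comp (by fun_prop : Measurable fun z : 𝓗 × A × V => ((z.1, z.2.2), z.2.1))⟩
  have : IsMarkovKernel η :=
    ⟨fun z => inferInstanceAs (IsProbabilityMeasure (condDistrib B _ μ (z.1, z.2.2)))⟩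
  refine condDistrib_comp_ae_eq_of_lintegral_eq (hB.comp measurable_fst) hobs (κ := η)
    fun F hF => ?_
  have hleft : Measurable fun p : Ω × A => F ((H p.1, p.2, Y p.2 p.1), B p.1) :=
    hF.comp (hobs.prodMk (hB.comp measurable_fst))
  have hright : Measurable fun p : Ω × A =>
      ∫⁻ b, F ((H p.1, p.2, Y p.2 p.1), b) ∂η (H p.1, p.2, Y p.2 p.1) :=
    hF.lintegral_kernel_prod_right'.comp hobs
  refine (lintegral_compProd_comap hH hleft).trans
    (Eq.trans ?_ (lintegral_compProd_comap hH hright).symm)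
  refine tsum_congr fun a => ?_
  have hκa : Measurable fun h => κ h {a} := Kernel.measurable_coe κ (measurableSet_singleton a)
  rw [← lintegral_lintegral_condDistrib (F := fun q => F ((q.1.1, a, q.1.2), q.2) * κ q.1.1 {a})
    hB (hH.prodMk (hY a)) (by fun_prop)]
  exact lintegral_congr fun ω => lintegral_mul_const (κ (H ω) {a})
    (hF.comp (measurable_prodMk_left (x := (H ω, a, Y a ω))))

variable [Fintype A]

lemma condEntropy_of_subsingleton {μ : Measure Ω} [IsProbabilityMeasure μ] [Subsingleton 𝓗]
    (hB : Measurable B) (hH : Measurable H) : condEntropy B H μ = shannonEntropy (μ.map B) := by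
  have := Measure.isProbabilityMeasure_map (μ := μ) hB.aemeasurable
  have hconst := condDistrib_comp_ae_eq_of_lintegral_eq (μ := μ) hB hH
    (κ := Kernel.const 𝓗 (μ.map B)) fun F hF => by
      obtain ⟨ω₀⟩ := nonempty_of_isProbabilityMeasure μ
      have hHω (ω : Ω) : H ω = H ω₀ := Subsingleton.elim _ _
      simp only [hHω, Kernel.const_apply, lintegral_const, measure_univ, mul_one]
      exact (lintegral_map (hF.comp (measurable_prodMk_left (x := H ω₀))) hB).symm
  rw [condEntropy, integral_congr_ae (hconst.mono fun ω hω => congrArg shannonEntropy hω)]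
  simp

lemma condEntropy_comp_of_measurePreserving {f : Ω' → Ω} {ν : Measure Ω'} [IsFiniteMeasure ν]
    (hf : MeasurePreserving f ν μ) (hB : Measurable B) (hH : Measurable H) :
    condEntropy (fun ω => B (f ω)) (fun ω => H (f ω)) ν = condEntropy B H μ := by
  obtain ⟨hf, rfl⟩ := hf
  have hcond := ae_of_ae_map (hH.comp hf).aemeasurable
    (condDistrib_map (ν := ν) hH.aemeasurable hB.aemeasurable hf.aemeasurable)
  have hmeas : Measurable fun ω => shannonEntropy (condDistrib B H (ν.map f) (H ω)) :=
    measurable_shannonEntropy_condDistrib.comp hH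
  rw [condEntropy, condEntropy, integral_map hf.aemeasurable hmeas.aestronglyMeasurable]
  exact integral_congr_ae (hcond.mono fun ω hω => congrArg shannonEntropy hω.symm)

lemma condEntropy_congr_of_equiv (hB : Measurable B) (hZ : Measurable Z) {φ : 𝓗 → 𝓩}
    {ψ : 𝓩 → 𝓗} (hφ : Measurable φ) (hψ : Measurable ψ) (hH : ∀ ω, H ω = ψ (Z ω))
    (hZH : ∀ᵐ ω ∂μ, Z ω = φ (H ω)) :
    condEntropy B H μ = condEntropy B Z μ :=
  integral_congr_ae ((condDistrib_comp_ae_eq_of_equiv hB hZ hφ hψ hH hZH).mono fun ω hω => by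
    simp only [hω])

lemma condEntropy_compProd_condDistrib (hB : Measurable B) (hH : Measurable H)
    (hY : ∀ a, Measurable (Y a)) :
    condEntropy (fun p => B p.1) (fun p => (H p.1, p.2, Y p.2 p.1))
        (μ ⊗ₘ (condDistrib B H μ).comap H hH)
      = condEntropy B H μ - samplingGain B H Y μ := by
  have hobs := measurable_observation hH hY
  have hcond := (condDistrib_compProd_ae_eq (μ := μ) hB hH hY (condDistrib B H μ)).mono
    fun p hp => congrArg shannonEntropy hp
  have hint := integrable_mul_shannonEntropy (B := fun p => B p.1)
    (μ := μ ⊗ₘ (condDistrib B H μ).comap H hH) hobs (f := fun _ => 1) measurable_const (by simp)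
  simp only [one_mul] at hint
  rw [samplingGain_eq_condEntropy_sub hB hH hY, sub_sub_cancel, condEntropy,
    integral_congr_ae hcond, Measure.integral_compProd (hint.congr hcond),
    ← integral_finsetSum _ fun c _ => integrable_mul_shannonEntropy (hH.prodMk (hY c))
      (measurable_postProb hH) fun ω => ⟨postProb_nonneg ω, postProb_le_one ω⟩]
  refine integral_congr_ae (.of_forall fun ω => ?_)
  exact integral_fintype .of_finite

end Sampling

lemma map_compProd_prod {Z X V A : Type*} [MeasurableSpace Z] [MeasurableSpace X]
    [MeasurableSpace V] [MeasurableSpace A] (μ : Measure Z) [SFinite μ] (η : Kernel Z X)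
    [IsSFiniteKernel η] (κ : Kernel Z V) [IsSFiniteKernel κ] {γ : X → A} (hγ : Measurable γ) :
    (μ ⊗ₘ (η ×ₖ κ)).map (fun p => ((p.1, p.2.2), γ p.2.1))
      = (μ ⊗ₘ κ) ⊗ₘ (η.map γ).comap Prod.fst measurable_fst := by
  refine Measure.ext_of_lintegral _ fun F hF => ?_
  have hFplay : Measurable fun p : Z × X × V => F ((p.1, p.2.2), γ p.2.1) := by fun_prop
  rw [lintegral_map hF (by fun_prop), Measure.lintegral_compProd hFplay,
    Measure.lintegral_compProd hF, Measure.lintegral_compProd hF.lintegral_kernel_prod_right']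
  refine lintegral_congr fun z => ?_
  rw [Kernel.prod_apply, lintegral_prod_symm' (fun q => F ((z, q.2), γ q.1)) (by fun_prop)]
  refine lintegral_congr fun y => ?_
  rw [Kernel.comap_apply, Kernel.map_apply _ hγ]
  exact (lintegral_map (hF.comp (measurable_prodMk_left (x := (z, y)))) hγ).symm

lemma measurable_finSnoc {X : Type*} [MeasurableSpace X] (t : ℕ) :
    Measurable fun p : (Fin t → X) × X => (Fin.snoc p.1 p.2 : Fin (t + 1) → X) := by
  refine measurable_pi_lambda _ fun i => ?_
  refine Fin.lastCases ?_ (fun j => ?_) i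
  · simpa using measurable_snd
  · simp only [Fin.snoc_castSucc]; fun_prop

namespace PartialFeedbackProblem

section Round

variable {S O A Y : Type*} [MeasurableSpace S] [MeasurableSpace O] [MeasurableSpace A]
  [MeasurableSpace Y]

/-- Extends the environment parameters and the history of `t` rounds by a next round in which the
action `p.2` is played against the outcome vector `p.1.2`. -/
def appendRound (t : ℕ) (p : ((O × (Fin t → A × Y)) × (A → Y)) × A) :
    O × (Fin (t + 1) → A × Y) :=
  (p.1.1.1, Fin.snoc p.1.1.2 (p.2, p.1.2 p.2))

lemma measurable_appendRound [Countable A] [DiscreteMeasurableSpace A] (t : ℕ) :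
    Measurable (appendRound (O := O) (A := A) (Y := Y) t) := by
  have hobs := measurable_observation (A := A)
    (H := fun ω : (O × (Fin t → A × Y)) × (A → Y) => ω.1.2) (Y := fun a ω => ω.2 a)
    (by fun_prop) (by fun_prop)
  exact (measurable_fst.comp (measurable_fst.comp measurable_fst)).prodMk
    ((measurable_finSnoc t).comp hobs)

variable [StandardBorelSpace O] [Nonempty O] (P : PartialFeedbackProblem S O A Y) {γ : O → A}

lemma measurePreserving_fst_roundLaw (t : ℕ) :
    MeasurePreserving Prod.fst (P.roundLaw γ t)
      (P.thompsonLaw γ t : Measure (O × (Fin t → A × Y))) :=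
  ⟨measurable_fst, Measure.fst_compProd _ _⟩

lemma compProd_roundLaw_eq_map [StandardBorelSpace A] [Nonempty A] (hγ : Measurable γ) (t : ℕ) :
    P.roundLaw γ t ⊗ₘ (condDistrib (fun ω => γ ω.1.1) (fun ω => ω.1.2) (P.roundLaw γ t)).comap
        (fun ω => ω.1.2) (by fun_prop)
      = ((P.thompsonLaw γ t : Measure (O × (Fin t → A × Y))) ⊗ₘ
          (Kernel.prodMkLeft O (condDistrib Prod.fst Prod.snd
              (P.thompsonLaw γ t : Measure (O × (Fin t → A × Y)))) ×ₖ
            Kernel.prodMkRight (Fin t → A × Y) P.outcome)).map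
        fun p => ((p.1, p.2.2), γ p.2.1) := by
  have hfst := P.measurePreserving_fst_roundLaw (γ := γ) t
  rw [map_compProd_prod _ _ _ hγ]
  refine Measure.compProd_congr ?_
  filter_upwards [hfst.quasiMeasurePreserving.ae
    (condDistrib_comp_measurePreserving_ae_eq hfst measurable_fst measurable_snd hγ)] with ω hω
  simpa only [Kernel.comap_apply, Kernel.map_apply _ hγ, Kernel.prodMkLeft_apply] using hω

variable [Countable A] [DiscreteMeasurableSpace A] [Nonempty A]

lemma measurePreserving_appendRound (hγ : Measurable γ) (t : ℕ) :
    MeasurePreserving (appendRound t)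
      (P.roundLaw γ t ⊗ₘ (condDistrib (fun ω => γ ω.1.1) (fun ω => ω.1.2) (P.roundLaw γ t)).comap
        (fun ω => ω.1.2) (by fun_prop))
      (P.thompsonLaw γ (t + 1) : Measure (O × (Fin (t + 1) → A × Y))) := by
  refine ⟨measurable_appendRound t, ?_⟩
  rw [P.compProd_roundLaw_eq_map hγ, Measure.map_map (measurable_appendRound t) (by fun_prop)]
  rfl

lemma isProbabilityMeasure_thompsonLaw (hγ : Measurable γ) (t : ℕ) :
    IsProbabilityMeasure (P.thompsonLaw γ t : Measure (O × (Fin t → A × Y))) := by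
  induction t with
  | zero => exact Measure.isProbabilityMeasure_map (by fun_prop)
  | succ t ih =>
    have : IsProbabilityMeasure (P.roundLaw γ t) :=
      inferInstanceAs (IsProbabilityMeasure (Measure.compProd _ _))
    rw [← (P.measurePreserving_appendRound hγ t).map_eq]
    exact Measure.isProbabilityMeasure_map (measurable_appendRound t).aemeasurable

lemma isProbabilityMeasure_roundLaw (hγ : Measurable γ) (t : ℕ) :
    IsProbabilityMeasure (P.roundLaw γ t) :=
  have := P.isProbabilityMeasure_thompsonLaw hγ t
  inferInstanceAs (IsProbabilityMeasure (Measure.compProd _ _))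

lemma thompsonLaw_map_fst (hγ : Measurable γ) (t : ℕ) :
    (P.thompsonLaw γ t : Measure (O × (Fin t → A × Y))).map Prod.fst = P.prior := by
  induction t with
  | zero => exact (Measure.map_map measurable_fst (by fun_prop)).trans Measure.map_id
  | succ t ih =>
    rw [← (P.measurePreserving_appendRound hγ t).map_eq,
      Measure.map_map measurable_fst (measurable_appendRound t)]
    change Measure.map ((Prod.fst ∘ Prod.fst) ∘ Prod.fst) _ = _
    rw [← Measure.map_map (measurable_fst.comp measurable_fst) measurable_fst, ← Measure.fst,
      Measure.fst_compProd, ← Measure.map_map measurable_fst measurable_fst,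
      (P.measurePreserving_fst_roundLaw t).map_eq, ih]

lemma ae_roundLaw_of_ae_outcome (hγ : Measurable γ) (t : ℕ) {p : (A → Y) → Prop}
    (hp : MeasurableSet {y | p y}) (h : ∀ᵐ θ ∂P.prior, ∀ᵐ y ∂P.outcome θ, p y) :
    ∀ᵐ ω ∂P.roundLaw γ t, p ω.2 := by
  rw [← P.thompsonLaw_map_fst hγ t] at h
  exact (Measure.ae_compProd_iff (measurable_snd hp)).2 (ae_of_ae_map measurable_fst.aemeasurable h)

lemma postProb_roundLaw_ae_eq_of_perfectlyRevealed [StandardBorelSpace Y]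
    (hP : P.PerfectlyRevealed) (hγ : Measurable γ) (t : ℕ) (a b c : A) :
    postProb (fun ω => γ ω.1.1) (fun ω => (ω.1.2, ω.2 a)) (P.roundLaw γ t) b
      =ᵐ[P.roundLaw γ t]
        postProb (fun ω => γ ω.1.1) (fun ω => (ω.1.2, ω.2 c)) (P.roundLaw γ t) b := by
  have hfull (a : A) : ∀ᵐ ω ∂P.roundLaw γ t,
      condDistrib (fun ω => γ ω.1.1) (fun ω => (ω.1.2, ω.2 a)) (P.roundLaw γ t) (ω.1.2, ω.2 a)
        = condDistrib (fun ω => γ ω.1.1) (fun ω => (ω.1.2, ω.2)) (P.roundLaw γ t)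
          (ω.1.2, ω.2) := by
    obtain ⟨f, hf, hfa⟩ := hP a
    have hrec : ∀ᵐ ω ∂P.roundLaw γ t, f (ω.2 a) = ω.2 :=
      P.ae_roundLaw_of_ae_outcome hγ t (measurableSet_eq_fun (by fun_prop) measurable_id) hfa
    exact condDistrib_comp_ae_eq_of_equiv (φ := fun h => (h.1, f h.2)) (ψ := fun z => (z.1, z.2 a))
      (by fun_prop) (by fun_prop) (by fun_prop) (by fun_prop) (fun ω => rfl)
      (hrec.mono fun ω hω => by rw [hω])
  filter_upwards [hfull a, hfull c] with ω ha hc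
  rw [postProb, postProb, ha, hc]

end Round

section Information

variable {S O A Y : Type*} [MeasurableSpace S] [MeasurableSpace O] [StandardBorelSpace O]
  [Nonempty O] [Fintype A] [MeasurableSpace A] [DiscreteMeasurableSpace A] [Nonempty A]
  [MeasurableSpace Y] (P : PartialFeedbackProblem S O A Y) {γ : O → A}

/-- The expected entropy of the posterior of `A⋆` after `t` rounds of Thompson sampling. -/
noncomputable def postEntropy (γ : O → A) (t : ℕ) : ℝ :=
  condEntropy (fun z => γ z.1) Prod.snd (P.thompsonLaw γ t : Measure (O × (Fin t → A × Y)))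

/-- The information about `A⋆` gained in the round following `t` rounds of Thompson sampling. -/
noncomputable def roundGain (γ : O → A) (t : ℕ) : ℝ :=
  samplingGain (fun ω => γ ω.1.1) (fun ω => ω.1.2) (fun a ω => ω.2 a) (P.roundLaw γ t)

/-- The expected total variation distance between the two conditional laws of `Y_{A⋆}` in the round
following `t` rounds of Thompson sampling. -/
noncomputable def roundTV (γ : O → A) (t : ℕ) : ℝ :=
  expectedTV (fun ω => γ ω.1.1) (fun ω => ω.1.2) (fun a ω => ω.2 a) (P.roundLaw γ t)

lemma postEntropy_nonneg (t : ℕ) : 0 ≤ P.postEntropy γ t := condEntropy_nonneg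

lemma condEntropy_roundLaw (hγ : Measurable γ) (t : ℕ) :
    condEntropy (fun ω => γ ω.1.1) (fun ω => ω.1.2) (P.roundLaw γ t) = P.postEntropy γ t := by
  have hB : Measurable fun z : O × (Fin t → A × Y) => γ z.1 := hγ.comp measurable_fst
  have hfst := P.measurePreserving_fst_roundLaw (γ := γ) t
  exact (condEntropy_comp_of_measurePreserving hfst hB measurable_snd :)

lemma postEntropy_succ (hγ : Measurable γ) (t : ℕ) :
    P.postEntropy γ (t + 1) = P.postEntropy γ t - P.roundGain γ t := by
  have hfirst : Measurable fun h : Fin (t + 1) → A × Y => Fin.init h :=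
    measurable_pi_lambda _ fun i => measurable_pi_apply i.castSucc
  rw [← P.condEntropy_roundLaw hγ t, roundGain,
    ← condEntropy_compProd_condDistrib (by fun_prop) (by fun_prop) (by fun_prop)]
  refine (condEntropy_comp_of_measurePreserving (B := fun z => γ z.1) (H := Prod.snd)
    (P.measurePreserving_appendRound hγ t) (by fun_prop) measurable_snd).symm.trans ?_
  refine condEntropy_congr_of_equiv (φ := fun h => (Fin.init h, h (Fin.last t)))
    (ψ := fun z => Fin.snoc z.1 z.2) (by simp only [appendRound]; fun_prop)
    (measurable_observation (H := fun ω : (O × (Fin t → A × Y)) × (A → Y) => ω.1.2)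
      (Y := fun a ω => ω.2 a) (by fun_prop) (by fun_prop))
    (hfirst.prodMk (measurable_pi_apply _)) (measurable_finSnoc t) (fun p => rfl)
    (.of_forall fun p => ?_)
  simp [appendRound]

lemma postEntropy_zero (hγ : Measurable γ) : P.postEntropy γ 0 = P.optEntropy γ := by
  have := P.isProbabilityMeasure_thompsonLaw hγ 0
  have hopt : (P.thompsonLaw γ 0 : Measure (O × (Fin 0 → A × Y))).map (fun z => γ z.1)
      = P.prior.map γ :=
    Measure.map_map (μ := P.prior) (f := fun θ => (θ, Fin.elim0)) (hγ.comp measurable_fst)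
      (by fun_prop)
  rw [postEntropy, condEntropy_of_subsingleton (by fun_prop) measurable_snd, hopt]
  rfl

variable [StandardBorelSpace Y] [Nonempty Y]

lemma lintegral_wassersteinOne_le_roundTV
    (hγ : Measurable γ) (t : ℕ) :
    ∫⁻ z, wassersteinOne discreteMetric (P.outcomeGivenOptHist γ t (γ z.1) (γ z.1) z.2)
        (P.outcomeGivenHist γ t (γ z.1) z.2)
        ∂(P.thompsonLaw γ t : Measure (O × (Fin t → A × Y)))
      ≤ ENNReal.ofReal (P.roundTV γ t) := by
  have hB : Measurable fun ω : (O × (Fin t → A × Y)) × (A → Y) => γ ω.1.1 := by fun_prop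
  have hH : Measurable fun ω : (O × (Fin t → A × Y)) × (A → Y) => ω.1.2 := by fun_prop
  have hY (a : A) : Measurable fun ω : (O × (Fin t → A × Y)) × (A → Y) => ω.2 a := by fun_prop
  rw [← (P.measurePreserving_fst_roundLaw t).map_eq]
  refine (lintegral_map_le _ _).trans ?_
  exact (lintegral_wassersteinOne_le_expectedTV hB hH hY (μ := P.roundLaw γ t) :)

lemma wassersteinBound_le_sqrt (hγ : Measurable γ) (T : ℕ)
    {C : ℝ} (hC : 0 ≤ C)
    (h : ∀ t l, 0 < l → P.roundTV γ t ≤ l / 2 * P.roundGain γ t + C / (2 * l)) :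
    P.wassersteinBound γ T ≤ ENNReal.ofReal (√(C * P.optEntropy γ * T)) := by
  have hTV_nonneg (t : ℕ) : 0 ≤ P.roundTV γ t :=
    Finset.sum_nonneg fun a _ => integral_nonneg fun ω => posPart_nonneg _
  have hH : 0 ≤ P.optEntropy γ := P.postEntropy_zero hγ ▸ P.postEntropy_nonneg 0
  have hgain : ∑ t ∈ Finset.range T, P.roundGain γ t ≤ P.optEntropy γ :=
    calc ∑ t ∈ Finset.range T, P.roundGain γ t
        = ∑ t ∈ Finset.range T, (P.postEntropy γ t - P.postEntropy γ (t + 1)) :=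
          Finset.sum_congr rfl fun t _ => by rw [P.postEntropy_succ hγ, sub_sub_cancel]
      _ = P.optEntropy γ - P.postEntropy γ T := by
          rw [Finset.sum_range_sub', P.postEntropy_zero hγ]
      _ ≤ P.optEntropy γ := sub_le_self _ (P.postEntropy_nonneg T)
  have hTV : ∑ t ∈ Finset.range T, P.roundTV γ t ≤ √(P.optEntropy γ * (C * T)) := by
    refine le_sqrt_mul_of_forall_le hH (by positivity) fun l hl => ?_
    calc ∑ t ∈ Finset.range T, P.roundTV γ t
        ≤ ∑ t ∈ Finset.range T, (l / 2 * P.roundGain γ t + C / (2 * l)) :=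
          Finset.sum_le_sum fun t _ => h t l hl
      _ = l / 2 * ∑ t ∈ Finset.range T, P.roundGain γ t + C * T / (2 * l) := by
          rw [Finset.sum_add_distrib, ← Finset.mul_sum, Finset.sum_const, Finset.card_range,
            nsmul_eq_mul]
          ring
      _ ≤ l / 2 * P.optEntropy γ + C * T / (2 * l) := by gcongr
  calc P.wassersteinBound γ T
      ≤ ∑ t ∈ Finset.range T, ENNReal.ofReal (P.roundTV γ t) :=
        Finset.sum_le_sum fun t _ => P.lintegral_wassersteinOne_le_roundTV hγ t
    _ = ENNReal.ofReal (∑ t ∈ Finset.range T, P.roundTV γ t) :=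
        (ENNReal.ofReal_sum_of_nonneg fun t _ => hTV_nonneg t).symm
    _ ≤ ENNReal.ofReal (√(C * P.optEntropy γ * T)) :=
        ENNReal.ofReal_le_ofReal (hTV.trans_eq (by ring_nf))

end Information

end PartialFeedbackProblem

theorem corollary5_general {S O A Y : Type*} [MeasurableSpace S]
    [MeasurableSpace O] [StandardBorelSpace O] [Nonempty O]
    [Fintype A] [MeasurableSpace A] [DiscreteMeasurableSpace A]
    [MeasurableSpace Y] [StandardBorelSpace Y] [Nonempty Y]
    (P : PartialFeedbackProblem S O A Y) (T : ℕ) {γ : O → A} (hγ : Measurable γ) :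
    P.wassersteinBound γ T ≤
        ENNReal.ofReal (√(1 / 2 * Fintype.card A * P.optEntropy γ * T)) ∧
      (P.PerfectlyRevealed →
        P.wassersteinBound γ T ≤ ENNReal.ofReal (√(1 / 2 * P.optEntropy γ * T))) := by
  have : Nonempty A := ‹Nonempty O›.map γ
  have hprob := P.isProbabilityMeasure_roundLaw hγ
  refine ⟨P.wassersteinBound_le_sqrt hγ T (by positivity) fun t l hl => ?_,
    fun hP => P.wassersteinBound_le_sqrt hγ T (by positivity) fun t l hl => ?_⟩
  · exact (expectedTV_le_samplingGain_add_card (by fun_prop) (by fun_prop) (by fun_prop)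
      hl).trans_eq (by rw [PartialFeedbackProblem.roundGain]; ring)
  · exact (expectedTV_le_samplingGain_add_one (by fun_prop) (by fun_prop) (by fun_prop) hl
      (P.postProb_roundLaw_ae_eq_of_perfectlyRevealed hP hγ t)).trans_eq (by
        rw [PartialFeedbackProblem.roundGain]; ring)

theorem corollary5 {S O A Y : Type*} [MeasurableSpace S]
    [MeasurableSpace O] [StandardBorelSpace O] [Nonempty O]
    [Fintype A] [MeasurableSpace A] [DiscreteMeasurableSpace A]
    [MeasurableSpace Y] [StandardBorelSpace Y] [Nonempty Y]
    (P : PartialFeedbackProblem S O A Y)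
    (hr : ∀ (y : A → Y) (a : A), P.reward y a ∈ Set.Icc (0 : ℝ) 1)
    (T : ℕ) (γ : O → A) (hγ : P.IsOptimalRule T γ) :
    P.wassersteinBound γ T ≤
        ENNReal.ofReal (Real.sqrt (1 / 2 * (Fintype.card A : ℝ) * P.optEntropy γ * (T : ℝ))) ∧
      (P.PerfectlyRevealed →
        P.wassersteinBound γ T ≤
          ENNReal.ofReal (Real.sqrt (1 / 2 * P.optEntropy γ * (T : ℝ)))) :=
  corollary5_general P T hγ.1
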